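/- **Laplace transform of the 2nd level fractional derivative on the half-axis.** All functions are complex-valued (in particular, real-valued functions are covered) and are taken modulo equality almost everywhere on $(0,\infty)$. $L_{loc}(\mathbb R_+)$ is the set of functions that are Lebesgue integrable on $(0,b)$ for every $b>0$. For $f\in L_{loc}(\mathbb R_+)$ let $I^0f=f$ and, for $\beta>0$, $$(I^\beta f)(x)=\frac1{\Gamma(\beta)}\int_0^x (x-t)^{\beta-1}f(t)\,dt,\qquad x>0 .$$ $AC_{loc}$ is the set of functions $g$ for which there are $c\in\mathbb C$ and $\varphi\in L_{loc}(\mathbb R_+)$ with $g(x)=c+\int_0^x\varphi(t)\,dt$ for almost all $x>0$; then $c$ and (almost everywhere) $\varphi$ are unique, and one puts $g(0)=c$, $\frac{dg}{dx}=\varphi$. The Laplace transform of $f\in L_{loc}(\mathbb R_+)$ at $s\in\mathbb C$ is $\mathcal L f(s)=\lim_{R\to\infty}\int_0^R f(t)e^{-st}\,dt$, and it is said to exist if this limit exists (for absolutely convergent integrals it is the Lebesgue integral over $(0,\infty)$). Powers $s^z$ are principal values. Let $0<\alpha\le 1$. (1) Let $\gamma_1,\gamma_2\ge 0$, $\alpha+\gamma_1\le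 1$, $\alpha+\gamma_1+\gamma_2\le 2$, and let $X_{2L+}$ be the set of all $f\in L_{loc}(\mathbb R_+)$ such that $I^{2-\alpha-\gamma_1-\gamma_2}f$ and $I^{\gamma_2}\frac{d}{dx}I^{2-\alpha-\gamma_1-\gamma_2}f$ belong to $AC_{loc}$. For $f\in X_{2L+}$ put $$D^{\alpha,(\gamma_1,\gamma_2)}_{2L+}f=I^{\gamma_1}\frac{d}{dx}I^{\gamma_2}\frac{d}{dx}I^{2-\alpha-\gamma_1-\gamma_2}f,\quad a_1=\Big(I^{\gamma_2}\frac{d}{dx}I^{2-\alpha-\gamma_1-\gamma_2}f\Big)(0),\quad a_2=\big(I^{2-\alpha-\gamma_1-\gamma_2}f\big)(0).$$ Assume $\gamma_2<1$ and $1<\alpha+\gamma_1+\gamma_2$. If $f\in X_{2L+}$, $\operatorname{Re}s>0$ and the Laplace transform of $D^{\alpha,(\gamma_1,\gamma_2)}_{2L+}f$ exists at $s$, then the Laplace transform of $f$ exists at $s$ and $$\mathcal L\big(D^{\alpha,(\gamma_1,\gamma_2)}_{2L+}f\big)(s)=s^\alpha\mathcal Lf(s)-a_1s^{-\gamma_1}-a_2s^{1-\gamma_1-\gamma_2}.$$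 (2) For $\gamma\ge 0$ with $\alpha+\gamma\le 1$ let $X_{H+}^{\gamma}$ be the set of all $f\in L_{loc}(\mathbb R_+)$ with $I^{1-\alpha-\gamma}f\in AC_{loc}$, and let $D^{\alpha,\gamma}_{H+}f=I^{\gamma}\frac{d}{dx}I^{1-\alpha-\gamma}f$ be the Hilfer derivative of $f\in X_{H+}^{\gamma}$. Let $\gamma_1,\gamma_2$ satisfy the conditions in the first sentence of (1). If $\gamma_2\ge1$, then, with $\gamma=\gamma_1+\gamma_2-1$ (so $\gamma=\gamma_1$ for $\gamma_2=1$), $X_{2L+}=X_{H+}^{\gamma}$, and for each $f$ in this space $D^{\alpha,(\gamma_1,\gamma_2)}_{2L+}f=D^{\alpha,\gamma}_{H+}f$ a.e., $a_1=0$, $a_2=(I^{1-\alpha-\gamma}f)(0)$. If $\alpha+\gamma_1+\gamma_2\le1$, then $X_{2L+}=X_{H+}^{\gamma_1}$, and for each $f$ in this space $D^{\alpha,(\gamma_1,\gamma_2)}_{2L+}f=D^{\alpha,\gamma_1}_{H+}f$ a.e., $a_1=(I^{1-\alpha-\gamma_1}f)(0)$, $a_2=0$. (3) Let $\operatorname{Re}s>0$.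 In each of the following cases, if the Laplace transform of the derivative of $f$ exists at $s$, then so does that of $f$, and the formula holds. Hilfer, for $\gamma_1\ge0$, $\alpha+\gamma_1\le1$, $f\in X_{H+}^{\gamma_1}$: $$\mathcal L(D^{\alpha,\gamma_1}_{H+}f)(s)=s^\alpha\mathcal Lf(s)-(I^{1-\alpha-\gamma_1}f)(0)\,s^{-\gamma_1};$$ Riemann–Liouville, $D^\alpha_{0+}f=\frac{d}{dx}I^{1-\alpha}f$ for $f\in L_{loc}(\mathbb R_+)$ with $I^{1-\alpha}f\in AC_{loc}$, which is the case $\gamma_1=0$ of the Hilfer derivative: $$\mathcal L(D^{\alpha}_{0+}f)(s)=s^\alpha\mathcal Lf(s)-(I^{1-\alpha}f)(0);$$ Caputo, $D^\alpha_{C+}f=I^{1-\alpha}\frac{df}{dx}$ for $f\in AC_{loc}$, which is the case $\gamma_1=1-\alpha$ of the Hilfer derivative: $$\mathcal L(D^{\alpha}_{C+}f)(s)=s^\alpha\mathcal Lf(s)-f(0)\,s^{\alpha-1}.$$ -/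

import Mathlib

open MeasureTheory Set Filter Topology

namespace FracCalc

/-- `f` belongs to `L_loc(ℝ₊)`, `ℝ₊ = [0, ∞)`: it is Lebesgue integrable on every `(0, b)`. -/
def LocInt (f : ℝ → ℂ) : Prop :=
  LocallyIntegrableOn f (Ici 0) volume

/-- The Riemann-Liouville fractional integral `I^α_{0+}` on the half-axis, `α ≥ 0`
(only the values at `x > 0` matter). -/
noncomputable def rlInt (α : ℝ) (f : ℝ → ℂ) (x : ℝ) : ℂ :=
  if α = 0 then f x
  else (1 / Real.Gamma α : ℝ) * ∫ t in (0 : ℝ)..x, (((x - t) ^ (α - 1) : ℝ) : ℂ) * f t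

/-- `g(x) = c + ∫₀ˣ φ(t) dt` for almost all `x > 0`, with `φ ∈ L_loc(ℝ₊)`: the function class of `g`
has the locally absolutely continuous representative `c + ∫₀ˣ φ`, whose value at `0` is `c` and
whose (weak) derivative is `φ`. -/
def IsACRep (g : ℝ → ℂ) (c : ℂ) (φ : ℝ → ℂ) : Prop :=
  LocInt φ ∧ ∀ᵐ x ∂(volume.restrict (Ioi (0 : ℝ))), g x = c + ∫ t in (0 : ℝ)..x, φ t

/-- `g ∈ AC_loc([0, ∞))` (as a class of functions modulo equality almost everywhere). -/
def MemAC (g : ℝ → ℂ) : Prop :=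
  ∃ c φ, IsACRep g c φ

open Classical in
/-- The value `g(0)` of (the continuous representative of) `g ∈ AC_loc([0, ∞))`. -/
noncomputable def valueAtZero (g : ℝ → ℂ) : ℂ :=
  if h : MemAC g then h.choose else 0

open Classical in
/-- The derivative `dg/dx ∈ L_loc(ℝ₊)` of `g ∈ AC_loc([0, ∞))`. -/
noncomputable def acDeriv (g : ℝ → ℂ) : ℝ → ℂ :=
  if h : MemAC g then h.choose_spec.choose else 0

/-- The initial value and the derivative are well defined, the latter almost everywhere. -/
theorem IsACRep.unique {g φ φ' : ℝ → ℂ} {c c' : ℂ} (h : IsACRep g c φ) (h' : IsACRep g c' φ') :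
    c = c' ∧ φ =ᵐ[volume.restrict (Ioi (0 : ℝ))] φ' := by
  have hint : ∀ {ψ : ℝ → ℂ}, LocInt ψ → ∀ b : ℝ, 0 ≤ b → IntervalIntegrable ψ volume 0 b := by
    intro ψ hψ b hb
    rw [intervalIntegrable_iff_integrableOn_Icc_of_le hb]
    exact hψ.integrableOn_compact_subset Icc_subset_Ici_self isCompact_Icc
  have hd : LocInt (fun t => φ t - φ' t) := h.1.sub h'.1
  set F : ℝ → ℂ := fun x => ∫ t in (0 : ℝ)..x, (φ t - φ' t) with hF
  have hcont : ContinuousOn F (Ici 0) := by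
    intro x hx
    have hx0 : (0 : ℝ) ≤ x + 1 := by have : (0 : ℝ) ≤ x := hx; linarith
    have h1 : ContinuousOn F (uIcc 0 (x + 1)) :=
      intervalIntegral.continuousOn_primitive_interval
        (by rw [uIcc_of_le hx0]
            exact hd.integrableOn_compact_subset Icc_subset_Ici_self isCompact_Icc)
    rw [uIcc_of_le hx0] at h1
    refine (h1 x ⟨hx, by linarith⟩).mono_of_mem_nhdsWithin ?_
    rw [← Ici_inter_Iic]
    exact inter_mem self_mem_nhdsWithin (mem_nhdsWithin_of_mem_nhds (Iic_mem_nhds (by linarith)))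
  have hae : ∀ᵐ x ∂(volume.restrict (Ioi (0 : ℝ))), F x = c' - c := by
    filter_upwards [h.2, h'.2, ae_restrict_mem measurableSet_Ioi] with x h1 h2 hx
    have hx' : (0 : ℝ) ≤ x := le_of_lt hx
    simp only [hF]
    rw [intervalIntegral.integral_sub (hint h.1 x hx') (hint h'.1 x hx')]
    rw [h1] at h2
    linear_combination h2
  have heq : EqOn F (fun _ => c' - c) (Ioi 0) :=
    Measure.eqOn_open_of_ae_eq hae isOpen_Ioi (hcont.mono Ioi_subset_Ici_self) continuousOn_const
  have heq' : EqOn F (fun _ => c' - c) (Ici 0) :=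
    heq.of_subset_closure hcont continuousOn_const Ioi_subset_Ici_self (by rw [closure_Ioi])
  have h0 : c' - c = 0 := by
    have := heq' (self_mem_Ici (a := (0 : ℝ)))
    simpa [hF] using this.symm
  refine ⟨(sub_eq_zero.mp h0).symm, ?_⟩
  have hz : ∀ᵐ x ∂(volume.restrict (Ioi (0 : ℝ))), φ x - φ' x = 0 := by
    have hn : ∀ n : ℕ, ∀ᵐ x ∂(volume.restrict (Ioo (0 : ℝ) n)), φ x - φ' x = 0 := by
      intro n
      have hii : IntervalIntegrable (fun t => φ t - φ' t) volume 0 n :=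
        hint hd n (Nat.cast_nonneg n)
      rw [ae_restrict_iff' measurableSet_Ioo]
      filter_upwards [hii.ae_hasDerivAt_integral] with x hx hxm
      have hm : x ∈ uIcc (0 : ℝ) n := by
        rw [uIcc_of_le (Nat.cast_nonneg n)]; exact Ioo_subset_Icc_self hxm
      have hD := hx hm 0 (left_mem_uIcc)
      have hc : HasDerivAt F 0 x := by
        refine (hasDerivAt_const x (c' - c)).congr_of_eventuallyEq ?_
        filter_upwards [Ioi_mem_nhds hxm.1] with y hy using heq hy
      exact hD.unique hc
    have hU : Ioi (0 : ℝ) ⊆ ⋃ n : ℕ, Ioo (0 : ℝ) n := by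
      intro x hx
      obtain ⟨n, hn⟩ := exists_nat_gt x
      exact mem_iUnion.2 ⟨n, hx, hn⟩
    exact ae_restrict_of_ae_restrict_of_subset hU ((ae_restrict_iUnion_iff _ _).2 hn)
  filter_upwards [hz] with x hx using sub_eq_zero.mp hx

theorem IsACRep.valueAtZero_eq {g φ : ℝ → ℂ} {c : ℂ} (h : IsACRep g c φ) :
    valueAtZero g = c := by
  have hm : MemAC g := ⟨c, φ, h⟩
  rw [valueAtZero, dif_pos hm]
  exact (hm.choose_spec.choose_spec.unique h).1

theorem IsACRep.acDeriv_ae_eq {g φ : ℝ → ℂ} {c : ℂ} (h : IsACRep g c φ) :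
    acDeriv g =ᵐ[volume.restrict (Ioi (0 : ℝ))] φ := by
  have hm : MemAC g := ⟨c, φ, h⟩
  rw [acDeriv, dif_pos hm]
  exact (hm.choose_spec.choose_spec.unique h).2

/-- The domain `X¹_{2L+}` of the 2nd level fractional derivative on the half-axis. -/
def MemDom2L (α γ₁ γ₂ : ℝ) (f : ℝ → ℂ) : Prop :=
  LocInt f ∧ MemAC (rlInt (2 - α - γ₁ - γ₂) f) ∧
    MemAC (rlInt γ₂ (acDeriv (rlInt (2 - α - γ₁ - γ₂) f)))

/-- The 2nd level fractional derivative `I^{γ₁} d/dx I^{γ₂} d/dx I^{2-α-γ₁-γ₂}`. -/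
noncomputable def deriv2L (α γ₁ γ₂ : ℝ) (f : ℝ → ℂ) : ℝ → ℂ :=
  rlInt γ₁ (acDeriv (rlInt γ₂ (acDeriv (rlInt (2 - α - γ₁ - γ₂) f))))

/-- `a₁ = (I^{γ₂} d/dx I^{2-α-γ₁-γ₂} f)(0)`. -/
noncomputable def coeffA1 (α γ₁ γ₂ : ℝ) (f : ℝ → ℂ) : ℂ :=
  valueAtZero (rlInt γ₂ (acDeriv (rlInt (2 - α - γ₁ - γ₂) f)))

/-- `a₂ = (I^{2-α-γ₁-γ₂} f)(0)`. -/
noncomputable def coeffA2 (α γ₁ γ₂ : ℝ) (f : ℝ → ℂ) : ℂ :=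
  valueAtZero (rlInt (2 - α - γ₁ - γ₂) f)

/-- The domain of the Hilfer fractional derivative on the half-axis. -/
def MemDomHilfer (α γ₁ : ℝ) (f : ℝ → ℂ) : Prop :=
  LocInt f ∧ MemAC (rlInt (1 - α - γ₁) f)

/-- The Hilfer fractional derivative `I^{γ₁} d/dx I^{1-α-γ₁}`. -/
noncomputable def derivHilfer (α γ₁ : ℝ) (f : ℝ → ℂ) : ℝ → ℂ :=
  rlInt γ₁ (acDeriv (rlInt (1 - α - γ₁) f))

/-- The domain of the Riemann-Liouville fractional derivative on the half-axis. -/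
def MemDomRL (α : ℝ) (f : ℝ → ℂ) : Prop :=
  LocInt f ∧ MemAC (rlInt (1 - α) f)

/-- The Riemann-Liouville fractional derivative `d/dx I^{1-α}`. -/
noncomputable def derivRL (α : ℝ) (f : ℝ → ℂ) : ℝ → ℂ :=
  acDeriv (rlInt (1 - α) f)

/-- The Caputo fractional derivative `I^{1-α} d/dx`; its domain is `AC_loc([0, ∞))`. -/
noncomputable def derivCaputo (α : ℝ) (f : ℝ → ℂ) : ℝ → ℂ :=
  rlInt (1 - α) (acDeriv f)

/-- The Laplace integral `∫₀^∞ f(t) e^{-st} dt` exists at `s`, as an improper integral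
(absolute convergence is not required). -/
def LaplaceExists (f : ℝ → ℂ) (s : ℂ) : Prop :=
  LocInt f ∧ ∃ F : ℂ,
    Tendsto (fun R : ℝ => ∫ t in (0 : ℝ)..R, f t * Complex.exp (-(s * t))) atTop (𝓝 F)

/-- The Laplace transform `(L f)(s) = ∫₀^∞ f(t) e^{-st} dt`. -/
noncomputable def laplace (f : ℝ → ℂ) (s : ℂ) : ℂ :=
  limUnder atTop (fun R : ℝ => ∫ t in (0 : ℝ)..R, f t * Complex.exp (-(s * t)))

/-- For absolutely convergent Laplace integrals, `laplace` is the Lebesgue integral. -/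
theorem laplace_eq_integral {f : ℝ → ℂ} {s : ℂ} (hf : LocInt f)
    (h : IntegrableOn (fun t : ℝ => f t * Complex.exp (-(s * t))) (Ioi 0)) :
    LaplaceExists f s ∧ laplace f s = ∫ t in Ioi (0 : ℝ), f t * Complex.exp (-(s * t)) := by
  have ht := intervalIntegral_tendsto_integral_Ioi 0 h tendsto_id
  exact ⟨⟨hf, _, ht⟩, ht.limUnder_eq⟩

end FracCalc

/-!
The semigroup property of the fractional integrals and `I^β k_γ = k_{β+γ}` for the power functions
`k_β(x) = x^{β-1} / Γ(β)` invert the fractional derivative `D`: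
`f = I^α D f + a₁ k_{α+γ₁} + a₂ k_{α+γ₁+γ₂-1}` almost everywhere, each term being of positive order
because `1 < α + γ₁ + γ₂`.

The formula is then the Laplace transform of this identity. For `Re s > 0` the transform of `k_β` is
`s^{-β}`: both sides are analytic in the half-plane, and on the real axis this is the definition of
`Γ`. The transform of `D f` may converge only conditionally, but the factor `e^{-st}` turns
`I^α D f = k_α * D f` into the convolution of an absolutely integrable function with one whose
primitive converges at infinity; the primitive of the convolution is `k_α e^{-st}` convolved with
that bounded convergent primitive, so it converges to the product of the two integrals.
-/

namespace FracCalc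

/-- Lebesgue measure on the open half-axis `(0, ∞)`, modulo whose null sets all functions are
taken. -/
noncomputable abbrev posVol : Measure ℝ := volume.restrict (Ioi 0)

section HalfLine

variable {E : Type*} [NormedAddCommGroup E] {a : ℝ}

theorem ae_restrict_Ioi_iff {μ : Measure ℝ} {p : ℝ → Prop} :
    (∀ᵐ x ∂μ.restrict (Ioi a), p x) ↔ ∀ b, ∀ᵐ x ∂μ.restrict (Ioc a b), p x := by
  refine ⟨fun h b => ae_restrict_of_ae_restrict_of_subset Ioc_subset_Ioi_self h, fun h => ?_⟩
  have hcover : Ioi a ⊆ ⋃ n : ℕ, Ioc a n := fun x hx =>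
    mem_iUnion.2 ((exists_nat_ge x).imp fun _ hn => ⟨hx, hn⟩)
  exact ae_restrict_of_ae_restrict_of_subset hcover ((ae_restrict_iUnion_iff _ _).2 fun n => h n)

theorem locallyIntegrableOn_Ici_iff {f : ℝ → E} :
    LocallyIntegrableOn f (Ici a) ↔ ∀ b, IntegrableOn f (Ioc a b) := by
  rw [locallyIntegrableOn_iff isClosed_Ici.isLocallyClosed]
  refine ⟨fun h b => ?_, fun h K hK hKc => ?_⟩
  · exact (h (Icc a b) Icc_subset_Ici_self isCompact_Icc).mono_set Ioc_subset_Icc_self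
  · obtain ⟨b, hb⟩ := hKc.bddAbove
    exact ((integrableOn_Icc_iff_integrableOn_Ioc (by finiteness)).2 (h b)).mono_set
      fun x hx => ⟨hK hx, hb hx⟩

theorem locallyIntegrableOn_Ici_congr {f g : ℝ → E} (hf : LocallyIntegrableOn f (Ici a))
    (h : f =ᵐ[volume.restrict (Ioi a)] g) : LocallyIntegrableOn g (Ici a) :=
  locallyIntegrableOn_Ici_iff.2 fun b =>
    (locallyIntegrableOn_Ici_iff.1 hf b).congr (ae_restrict_Ioi_iff.1 h b)

theorem integrableOn_Ioi_indicator_Iic {f : ℝ → E} (hf : LocallyIntegrableOn f (Ici a)) (b : ℝ) :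
    IntegrableOn (indicator (Iic b) f) (Ioi a) := by
  rw [IntegrableOn, integrable_indicator_iff measurableSet_Iic, IntegrableOn,
    Measure.restrict_restrict measurableSet_Iic, inter_comm, Ioi_inter_Iic]
  exact locallyIntegrableOn_Ici_iff.1 hf b

theorem intervalIntegrable_of_locallyIntegrableOn_Ici {f : ℝ → E}
    (hf : LocallyIntegrableOn f (Ici a)) {b : ℝ} (hb : a ≤ b) : IntervalIntegrable f volume a b :=
  (intervalIntegrable_iff_integrableOn_Ioc_of_le hb).2 (locallyIntegrableOn_Ici_iff.1 hf b)

theorem intervalIntegral_congr_ae_Ioi [NormedSpace ℝ E] {f g : ℝ → E}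
    (h : f =ᵐ[volume.restrict (Ioi a)] g) {b : ℝ} (hb : a ≤ b) :
    ∫ t in a..b, f t = ∫ t in a..b, g t := by
  rw [intervalIntegral.integral_of_le hb, intervalIntegral.integral_of_le hb]
  exact integral_congr_ae (ae_restrict_Ioi_iff.1 h b)

section Primitive

variable [NormedSpace ℝ E] {f : ℝ → E}

theorem continuous_setIntegral_Ioc (hf : LocallyIntegrableOn f (Ici a)) :
    Continuous fun y => ∫ t in Ioc a y, f t := by
  have hint (b c : ℝ) : IntervalIntegrable (indicator (Ioi a) f) volume b c := by
    rw [intervalIntegrable_iff, integrableOn_indicator_iff measurableSet_Ioi]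
    exact (locallyIntegrableOn_Ici_iff.1 hf (max b c)).mono_set fun x hx => ⟨hx.1, hx.2.2⟩
  refine (intervalIntegral.continuous_primitive hint a).congr fun y => ?_
  rcases le_total a y with hy | hy
  · rw [intervalIntegral.integral_of_le hy, setIntegral_indicator measurableSet_Ioi,
      inter_eq_left.2 Ioc_subset_Ioi_self]
  · rw [intervalIntegral.integral_of_ge hy, setIntegral_indicator measurableSet_Ioi,
      Ioc_eq_empty hy.not_gt, (Ioc_disjoint_Ioi_same).inter_eq, setIntegral_empty, neg_zero]

theorem exists_norm_setIntegral_Ioc_le {y : E} (hf : LocallyIntegrableOn f (Ici a))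
    (hy : Tendsto (fun R => ∫ t in Ioc a R, f t) atTop (𝓝 y)) :
    ∃ C, ∀ R, ‖∫ t in Ioc a R, f t‖ ≤ C := by
  obtain ⟨R₀, hR₀⟩ := eventually_atTop.1 (hy.norm.eventually_le_const (lt_add_one ‖y‖))
  obtain ⟨C, hC⟩ := (isCompact_Icc (a := a) (b := R₀)).exists_bound_of_continuousOn
    (continuous_setIntegral_Ioc hf).continuousOn
  refine ⟨max C (‖y‖ + 1), fun R => ?_⟩
  rcases lt_or_ge R a with ha | ha
  · rw [Ioc_eq_empty ha.not_gt, setIntegral_empty, norm_zero]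
    exact le_max_of_le_right (by positivity)
  rcases le_total R R₀ with h | h
  · exact le_max_of_le_left (hC R ⟨ha, h⟩)
  · exact le_max_of_le_right (hR₀ R h)

end Primitive

end HalfLine

/-! ### Convolution on the half-axis -/

section PosConvolution

variable {E E' E'' F F' G : Type*} [NormedAddCommGroup E] [NormedSpace ℝ E]
  [NormedAddCommGroup E'] [NormedSpace ℝ E'] [NormedAddCommGroup E''] [NormedSpace ℝ E'']
  [NormedAddCommGroup F] [NormedSpace ℝ F] [NormedAddCommGroup F'] [NormedSpace ℝ F']
  [NormedAddCommGroup G] [NormedSpace ℝ G]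
  {f f' : ℝ → E} {g g' : ℝ → E'} {k : ℝ → E''} (L : E →L[ℝ] E' →L[ℝ] F)

local notation:67 f:67 "⋆₊[" L:67 "]" g:68 => posConvolution f g L volume

theorem posConvolution_of_pos (f : ℝ → E) (g : ℝ → E') {x : ℝ} (hx : 0 < x) :
    (f ⋆₊[L] g) x = ∫ t in (0 : ℝ)..x, L (f t) (g (x - t)) :=
  indicator_of_mem hx _

theorem indicator_Ioi_posConvolution (f : ℝ → E) (g : ℝ → E') :
    indicator (Ioi 0) (f ⋆₊[L] g) = f ⋆₊[L] g := by
  rw [posConvolution, indicator_indicator, inter_self]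

theorem posConvolution_congr_ae (hf : f =ᵐ[posVol] f') (hg : g =ᵐ[posVol] g') :
    f ⋆₊[L] g = f' ⋆₊[L] g' := by
  simp only [posConvolution_eq_convolution_indicator]
  exact convolution_congr L ((ae_eq_restrict_iff_indicator_ae_eq measurableSet_Ioi).1 hf)
    ((ae_eq_restrict_iff_indicator_ae_eq measurableSet_Ioi).1 hg)

theorem posConvolution_flip (f : ℝ → E) (g : ℝ → E') : g ⋆₊[L.flip] f = f ⋆₊[L] g := by
  simp only [posConvolution_eq_convolution_indicator, convolution_flip]

theorem eqOn_Iic_posConvolution {b : ℝ} (hf : EqOn f f' (Iic b)) (hg : EqOn g g' (Iic b)) :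
    EqOn (f ⋆₊[L] g) (f' ⋆₊[L] g') (Iic b) := by
  intro x hx
  rcases le_or_gt x 0 with hx0 | hx0
  · simp only [posConvolution, indicator_of_notMem (notMem_Ioi.2 hx0)]
  rw [posConvolution_of_pos L f g hx0, posConvolution_of_pos L f' g' hx0]
  refine intervalIntegral.integral_congr fun t ht => ?_
  rw [uIcc_of_le hx0.le] at ht
  have htb : t ≤ b := ht.2.trans hx
  have hxtb : x - t ≤ b := (sub_le_self x ht.1).trans hx
  simp only [hf htb, hg hxtb]

theorem posConvolution_add_ae_of_integrableOn (hf : IntegrableOn f (Ioi 0))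
    (hf' : IntegrableOn f' (Ioi 0)) (hg : IntegrableOn g (Ioi 0)) :
    (f + f') ⋆₊[L] g =ᵐ[volume] f ⋆₊[L] g + f' ⋆₊[L] g := by
  rw [← integrable_indicator_iff measurableSet_Ioi] at hf hf' hg
  filter_upwards [hf.ae_convolution_exists L hg, hf'.ae_convolution_exists L hg] with x h h'
  simp only [Pi.add_apply, posConvolution_eq_convolution_indicator, indicator_add']
  exact h.add_distrib h'

variable {L₂ : F →L[ℝ] E'' →L[ℝ] G} {L₃ : E →L[ℝ] F' →L[ℝ] G} {L₄ : E' →L[ℝ] E'' →L[ℝ] F'}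

theorem posConvolution_assoc_ae_of_integrableOn [CompleteSpace F] [CompleteSpace F']
    [CompleteSpace G] (hL : ∀ u v w, L₂ (L u v) w = L₃ u (L₄ v w))
    (hf : IntegrableOn f (Ioi 0)) (hg : IntegrableOn g (Ioi 0)) (hk : IntegrableOn k (Ioi 0)) :
    (f ⋆₊[L] g) ⋆₊[L₂] k =ᵐ[volume] f ⋆₊[L₃] (g ⋆₊[L₄] k) := by
  rw [← integrable_indicator_iff measurableSet_Ioi] at hf hg hk
  filter_upwards [hf.norm.ae_convolution_exists (ContinuousLinearMap.mul ℝ ℝ)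
    (hg.norm.integrable_convolution (ContinuousLinearMap.mul ℝ ℝ) hk.norm)] with x hx
  rw [posConvolution_eq_convolution_indicator (f ⋆₊[L] g) k L₂ volume,
    posConvolution_eq_convolution_indicator f (g ⋆₊[L₄] k) L₃ volume,
    indicator_Ioi_posConvolution, indicator_Ioi_posConvolution,
    posConvolution_eq_convolution_indicator f g L volume,
    posConvolution_eq_convolution_indicator g k L₄ volume]
  exact convolution_assoc L L₂ L₃ L₄ hL hf.aestronglyMeasurable hg.aestronglyMeasurable
    hk.aestronglyMeasurable (hf.ae_convolution_exists L hg)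
    (hg.norm.ae_convolution_exists _ hk.norm) hx

section LocallyIntegrable

variable (hf : LocallyIntegrableOn f (Ici 0)) (hg : LocallyIntegrableOn g (Ici 0))
include hf hg

theorem locallyIntegrableOn_posConvolution : LocallyIntegrableOn (f ⋆₊[L] g) (Ici 0) := by
  refine locallyIntegrableOn_Ici_iff.2 fun b => ?_
  have h := integrable_posConvolution (integrableOn_Ioi_indicator_Iic hf b)
    (integrableOn_Ioi_indicator_Iic hg b) L
  exact h.integrableOn.congr_fun
    ((eqOn_Iic_posConvolution L eqOn_indicator eqOn_indicator).mono fun _ hx => hx.2)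
    measurableSet_Ioc

theorem posConvolution_add_ae (hf' : LocallyIntegrableOn f' (Ici 0)) :
    (f + f') ⋆₊[L] g =ᵐ[posVol] f ⋆₊[L] g + f' ⋆₊[L] g := by
  refine ae_restrict_Ioi_iff.2 fun b => ?_
  have htrunc (p : ℝ → E) : EqOn (p ⋆₊[L] g) (indicator (Iic b) p ⋆₊[L] indicator (Iic b) g)
      (Iic b) := eqOn_Iic_posConvolution L eqOn_indicator.symm eqOn_indicator.symm
  have h := posConvolution_add_ae_of_integrableOn L (integrableOn_Ioi_indicator_Iic hf b)
    (integrableOn_Ioi_indicator_Iic hf' b) (integrableOn_Ioi_indicator_Iic hg b)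
  filter_upwards [ae_restrict_of_ae h, ae_restrict_mem measurableSet_Ioc] with x hx hxb
  rw [Pi.add_apply, htrunc (f + f') hxb.2, htrunc f hxb.2, htrunc f' hxb.2, indicator_add', hx,
    Pi.add_apply]

theorem posConvolution_assoc_ae [CompleteSpace F] [CompleteSpace F'] [CompleteSpace G]
    (hL : ∀ u v w, L₂ (L u v) w = L₃ u (L₄ v w)) (hk : LocallyIntegrableOn k (Ici 0)) :
    (f ⋆₊[L] g) ⋆₊[L₂] k =ᵐ[posVol] f ⋆₊[L₃] (g ⋆₊[L₄] k) := by
  refine ae_restrict_Ioi_iff.2 fun b => ?_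
  have h := posConvolution_assoc_ae_of_integrableOn L hL (integrableOn_Ioi_indicator_Iic hf b)
    (integrableOn_Ioi_indicator_Iic hg b) (integrableOn_Ioi_indicator_Iic hk b)
  have hfg := eqOn_Iic_posConvolution L (eqOn_indicator (s := Iic b) (f := f)).symm
    (eqOn_indicator (s := Iic b) (f := g)).symm
  have hgk := eqOn_Iic_posConvolution L₄ (eqOn_indicator (s := Iic b) (f := g)).symm
    (eqOn_indicator (s := Iic b) (f := k)).symm
  filter_upwards [ae_restrict_of_ae h, ae_restrict_mem measurableSet_Ioc] with x hx hxb
  rw [eqOn_Iic_posConvolution L₂ hfg eqOn_indicator.symm hxb.2, hx,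
    eqOn_Iic_posConvolution L₃ eqOn_indicator.symm hgk hxb.2]

end LocallyIntegrable

section ImproperIntegral

variable [CompleteSpace E'] [CompleteSpace F]

theorem setIntegral_Iic_convolution (hf : Integrable f) (hg : Integrable g) (R : ℝ) :
    ∫ x in Iic R, convolution f g L volume x = ∫ t, L (f t) (∫ x in Iic (R - t), g x) := by
  have hint : Integrable (Function.uncurry fun x t => L (f t) (g (x - t)))
      ((volume.restrict (Iic R)).prod volume) :=
    (hf.convolution_integrand L hg).mono_measure
      (Measure.prod_mono Measure.restrict_le_self le_rfl)
  simp only [convolution]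
  rw [integral_integral_swap hint]
  refine integral_congr_ae (Eventually.of_forall fun t => ?_)
  have hshift : ∫ x in Iic R, g (x - t) = ∫ x in Iic (R - t), g x := by
    have h := (measurePreserving_sub_right volume t).setIntegral_preimage_emb
      (measurableEmbedding_subRight t) g (Iic (R - t))
    rwa [preimage_sub_const_Iic, sub_add_cancel] at h
  exact ((L (f t)).integral_comp_comm (hg.comp_sub_right t).integrableOn).trans
    (congrArg (L (f t)) hshift)

theorem setIntegral_Ioc_posConvolution (hf : IntegrableOn f (Ioi 0))
    (hg : LocallyIntegrableOn g (Ici 0)) (R : ℝ) :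
    ∫ x in Ioc 0 R, (f ⋆₊[L] g) x = ∫ t in Ioi 0, L (f t) (∫ x in Ioc 0 (R - t), g x) := by
  have hgR := integrableOn_Ioi_indicator_Iic hg R
  have htrunc : EqOn (f ⋆₊[L] g) (f ⋆₊[L] indicator (Iic R) g) (Iic R) :=
    eqOn_Iic_posConvolution L (eqOn_refl f _) eqOn_indicator.symm
  calc ∫ x in Ioc 0 R, (f ⋆₊[L] g) x
      = ∫ x in Iic R, (f ⋆₊[L] indicator (Iic R) g) x := by
        rw [← setIntegral_congr_fun measurableSet_Iic htrunc, ← Ioi_inter_Iic, inter_comm,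
          ← setIntegral_indicator measurableSet_Ioi, indicator_Ioi_posConvolution]
    _ = ∫ t, L (indicator (Ioi 0) f t)
          (∫ x in Iic (R - t), indicator (Ioi 0) (indicator (Iic R) g) x) := by
        rw [← integrable_indicator_iff measurableSet_Ioi] at hf hgR
        simp only [posConvolution_eq_convolution_indicator]
        exact setIntegral_Iic_convolution L hf hgR R
    _ = ∫ t in Ioi 0, L (f t) (∫ x in Ioc 0 (R - t), g x) := by
        rw [← integral_indicator measurableSet_Ioi]
        refine integral_congr_ae (Eventually.of_forall fun t => ?_)
        rcases le_or_gt t 0 with ht | ht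
        · simp [indicator_of_notMem (notMem_Ioi.2 ht)]
        have hset : Iic (R - t) ∩ Ioi 0 ∩ Iic R = Ioc 0 (R - t) := by
          ext x; simp only [mem_inter_iff, mem_Iic, mem_Ioi, mem_Ioc]; grind
        simp only [indicator_of_mem (mem_Ioi.2 ht), setIntegral_indicator measurableSet_Ioi,
          setIntegral_indicator measurableSet_Iic, hset]

theorem tendsto_setIntegral_Ioc_posConvolution [CompleteSpace E] {y : E'}
    (hf : IntegrableOn f (Ioi 0)) (hg : LocallyIntegrableOn g (Ici 0))
    (hy : Tendsto (fun R => ∫ t in Ioc 0 R, g t) atTop (𝓝 y)) :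
    Tendsto (fun R => ∫ t in Ioc 0 R, (f ⋆₊[L] g) t) atTop
      (𝓝 (L (∫ t in Ioi 0, f t) y)) := by
  obtain ⟨C, hC⟩ := exists_norm_setIntegral_Ioc_le hg hy
  have hlimit : L (∫ t in Ioi 0, f t) y = ∫ t in Ioi 0, L (f t) y :=
    ((L.flip y).integral_comp_comm hf).symm
  simp only [setIntegral_Ioc_posConvolution L hf hg, hlimit]
  refine tendsto_integral_filter_of_dominated_convergence (fun t => ‖L‖ * ‖f t‖ * C)
    (Eventually.of_forall fun R => ?_)
    (Eventually.of_forall fun R => Eventually.of_forall fun t => ?_)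
    ((hf.norm.const_mul _).mul_const C) (Eventually.of_forall fun t => ?_)
  · exact L.aestronglyMeasurable_comp₂ hf.aestronglyMeasurable
      ((continuous_setIntegral_Ioc hg).comp (continuous_sub_left R)).aestronglyMeasurable
  · exact (L.le_opNorm₂ _ _).trans (by gcongr; exact hC _)
  · exact ((L (f t)).continuous.tendsto y).comp
      (hy.comp (tendsto_atTop_add_const_right atTop (-t) tendsto_id))

end ImproperIntegral

end PosConvolution

/-! ### Riemann-Liouville fractional integrals -/

local notation:67 f:67 "⋆₊" g:68 => posConvolution f g (ContinuousLinearMap.mul ℝ ℂ) volume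

/-- The kernel `t ^ (β - 1) / Γ(β)`, convolution with which is the fractional integral of order
`β > 0`; at `t ≤ 0` its values are immaterial. -/
noncomputable def rlKernel (β t : ℝ) : ℂ := ((t ^ (β - 1) / Real.Gamma β : ℝ) : ℂ)

theorem rlKernel_one (t : ℝ) : rlKernel 1 t = 1 := by simp [rlKernel]

theorem rlKernel_eq_cpow (β : ℝ) {t : ℝ} (ht : 0 ≤ t) :
    rlKernel β t = (Complex.Gamma β)⁻¹ * (t : ℂ) ^ ((β : ℂ) - 1) := by
  rw [rlKernel, Complex.Gamma_ofReal, Complex.ofReal_div, Complex.ofReal_cpow ht,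
    Complex.ofReal_sub, Complex.ofReal_one, div_eq_inv_mul]

theorem locInt_rlKernel {β : ℝ} (hβ : 0 < β) : LocInt (rlKernel β) := by
  refine locallyIntegrableOn_Ici_iff.2 fun b => ?_
  have h : IntervalIntegrable (fun t : ℝ => t ^ (β - 1)) volume 0 b :=
    intervalIntegral.intervalIntegrable_rpow' (by linarith)
  exact (h.1.div_const _).ofReal

theorem posConvolution_rlKernel {a b : ℝ} (ha : 0 < a) (hb : 0 < b) {x : ℝ} (hx : 0 < x) :
    (rlKernel a ⋆₊ rlKernel b) x = rlKernel (a + b) x := by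
  have hΓ : Complex.Gamma a ≠ 0 ∧ Complex.Gamma b ≠ 0 ∧ Complex.Gamma (a + b) ≠ 0 := by
    refine ⟨?_, ?_, ?_⟩ <;> refine Complex.Gamma_ne_zero_of_re_pos ?_ <;> simp <;> linarith
  obtain ⟨hΓa, hΓb, hΓab⟩ := hΓ
  have hBeta : Complex.Gamma a * Complex.Gamma b =
      Complex.Gamma (a + b) * Complex.betaIntegral a b :=
    Complex.Gamma_mul_Gamma_eq_betaIntegral (by simpa using ha) (by simpa using hb)
  calc (rlKernel a ⋆₊ rlKernel b) x
      = ∫ t in (0 : ℝ)..x, rlKernel a t * rlKernel b (x - t) := posConvolution_of_pos _ _ _ hx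
    _ = (Complex.Gamma a)⁻¹ * (Complex.Gamma b)⁻¹ *
          ∫ t in (0 : ℝ)..x, (t : ℂ) ^ ((a : ℂ) - 1) * ((x : ℂ) - t) ^ ((b : ℂ) - 1) := by
        rw [← intervalIntegral.integral_const_mul]
        refine intervalIntegral.integral_congr fun t ht => ?_
        rw [uIcc_of_le hx.le] at ht
        simp only [rlKernel_eq_cpow _ ht.1, rlKernel_eq_cpow _ (sub_nonneg.2 ht.2),
          Complex.ofReal_sub]
        ring
    _ = (Complex.Gamma (a + b))⁻¹ * (x : ℂ) ^ ((a : ℂ) + b - 1) := by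
        rw [Complex.betaIntegral_scaled a b hx]
        field_simp
        rw [hBeta]
        ring
    _ = rlKernel (a + b) x := by rw [rlKernel_eq_cpow _ hx.le, Complex.ofReal_add]

section RLInt

variable {f g : ℝ → ℂ} {a b β : ℝ}

theorem rlInt_zero (f : ℝ → ℂ) : rlInt 0 f = f :=
  funext fun _ => if_pos rfl

theorem rlInt_one (f : ℝ → ℂ) (x : ℝ) : rlInt 1 f x = ∫ t in (0 : ℝ)..x, f t := by
  simp [rlInt]

theorem rlInt_ae_eq_posConvolution (hβ : β ≠ 0) (f : ℝ → ℂ) :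
    rlInt β f =ᵐ[posVol] f ⋆₊ rlKernel β := by
  filter_upwards [ae_restrict_mem measurableSet_Ioi] with x hx
  rw [rlInt, if_neg hβ, posConvolution_of_pos _ _ _ hx, ← intervalIntegral.integral_const_mul]
  refine intervalIntegral.integral_congr fun t _ => ?_
  simp only [rlKernel, ContinuousLinearMap.mul_apply', Complex.ofReal_div, Complex.ofReal_one]
  ring

theorem LocInt.congr (hf : LocInt f) (h : f =ᵐ[posVol] g) : LocInt g :=
  locallyIntegrableOn_Ici_congr hf h

theorem LocInt.const_smul (hf : LocInt f) (c : ℂ) : LocInt (c • f) :=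
  locallyIntegrableOn_Ici_iff.2 fun b => (locallyIntegrableOn_Ici_iff.1 hf b).smul c

theorem LocInt.rlInt (hf : LocInt f) (hβ : 0 ≤ β) : LocInt (rlInt β f) := by
  rcases hβ.eq_or_lt with rfl | hβ
  · rwa [rlInt_zero]
  · exact LocInt.congr (locallyIntegrableOn_posConvolution _ hf (locInt_rlKernel hβ))
      (rlInt_ae_eq_posConvolution hβ.ne' f).symm

theorem rlInt_congr (h : f =ᵐ[posVol] g) (β : ℝ) : rlInt β f =ᵐ[posVol] rlInt β g := by
  rcases eq_or_ne β 0 with rfl | hβ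
  · rwa [rlInt_zero, rlInt_zero]
  refine (rlInt_ae_eq_posConvolution hβ f).trans ?_
  rw [posConvolution_congr_ae _ h (ae_eq_refl _)]
  exact (rlInt_ae_eq_posConvolution hβ g).symm

theorem rlInt_add (hf : LocInt f) (hg : LocInt g) (hβ : 0 ≤ β) :
    rlInt β (f + g) =ᵐ[posVol] rlInt β f + rlInt β g := by
  rcases hβ.eq_or_lt with rfl | hβ
  · simp only [rlInt_zero, ae_eq_refl]
  have hconv := rlInt_ae_eq_posConvolution hβ.ne'
  exact (hconv (f + g)).trans ((posConvolution_add_ae _ hf (locInt_rlKernel hβ) hg).trans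
    ((hconv f).add (hconv g)).symm)

theorem rlInt_const_smul (c : ℂ) (f : ℝ → ℂ) (β : ℝ) : rlInt β (c • f) = c • rlInt β f := by
  funext x
  simp only [rlInt, Pi.smul_apply, smul_eq_mul, mul_left_comm _ c,
    intervalIntegral.integral_const_mul, mul_ite]

theorem rlInt_rlKernel (ha : 0 ≤ a) (hb : 0 < b) :
    rlInt a (rlKernel b) =ᵐ[posVol] rlKernel (a + b) := by
  rcases ha.eq_or_lt with rfl | ha
  · rw [rlInt_zero, zero_add]
  refine (rlInt_ae_eq_posConvolution ha.ne' _).trans ?_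
  filter_upwards [ae_restrict_mem measurableSet_Ioi] with x hx
  rw [posConvolution_rlKernel hb ha hx, add_comm]

theorem rlInt_rlInt (hf : LocInt f) (ha : 0 ≤ a) (hb : 0 ≤ b) :
    rlInt a (rlInt b f) =ᵐ[posVol] rlInt (a + b) f := by
  rcases ha.eq_or_lt with rfl | ha
  · rw [rlInt_zero, zero_add]
  rcases hb.eq_or_lt with rfl | hb
  · rw [rlInt_zero, add_zero]
  have hassoc : (f ⋆₊ rlKernel b) ⋆₊ rlKernel a =ᵐ[posVol] f ⋆₊ (rlKernel b ⋆₊ rlKernel a) :=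
    posConvolution_assoc_ae _ hf (locInt_rlKernel hb) mul_assoc (locInt_rlKernel ha)
  have hkernel : rlKernel b ⋆₊ rlKernel a =ᵐ[posVol] rlKernel (a + b) :=
    (rlInt_ae_eq_posConvolution ha.ne' _).symm.trans (rlInt_rlKernel ha.le hb)
  rw [posConvolution_congr_ae _ (ae_eq_refl f) hkernel] at hassoc
  calc rlInt a (rlInt b f)
      =ᵐ[posVol] rlInt a (f ⋆₊ rlKernel b) :=
        rlInt_congr (rlInt_ae_eq_posConvolution hb.ne' f) a
    _ =ᵐ[posVol] (f ⋆₊ rlKernel b) ⋆₊ rlKernel a := rlInt_ae_eq_posConvolution ha.ne' _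
    _ =ᵐ[posVol] f ⋆₊ rlKernel (a + b) := hassoc
    _ =ᵐ[posVol] rlInt (a + b) f := (rlInt_ae_eq_posConvolution (add_pos ha hb).ne' f).symm

theorem rlInt_one_injective (hf : LocInt f) (hg : LocInt g)
    (h : rlInt 1 f =ᵐ[posVol] rlInt 1 g) : f =ᵐ[posVol] g := by
  have hrep_f : IsACRep (rlInt 1 f) 0 f :=
    ⟨hf, Eventually.of_forall fun x => by rw [rlInt_one, zero_add]⟩
  have hrep_g : IsACRep (rlInt 1 f) 0 g :=
    ⟨hg, h.mono fun x hx => by rw [hx, rlInt_one, zero_add]⟩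
  exact (hrep_f.unique hrep_g).2

theorem rlInt_injective (hf : LocInt f) (hg : LocInt g) (hβ : 0 ≤ β)
    (h : rlInt β f =ᵐ[posVol] rlInt β g) : f =ᵐ[posVol] g := by
  have hnat (n : ℕ) (hn : rlInt n f =ᵐ[posVol] rlInt n g) : f =ᵐ[posVol] g := by
    induction n with
    | zero => simpa only [Nat.cast_zero, rlInt_zero] using hn
    | succ n ih =>
      refine ih (rlInt_one_injective (hf.rlInt n.cast_nonneg) (hg.rlInt n.cast_nonneg) ?_)
      rw [Nat.cast_succ, add_comm] at hn
      exact (rlInt_rlInt hf zero_le_one n.cast_nonneg).trans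
        (hn.trans (rlInt_rlInt hg zero_le_one n.cast_nonneg).symm)
  obtain ⟨n, hn⟩ := exists_nat_ge β
  have hcompose (p : ℝ → ℂ) (hp : LocInt p) : rlInt (n - β) (rlInt β p) =ᵐ[posVol] rlInt n p := by
    simpa only [sub_add_cancel] using rlInt_rlInt hp (sub_nonneg.2 hn) hβ
  exact hnat n ((hcompose f hf).symm.trans ((rlInt_congr h _).trans (hcompose g hg)))

theorem rlInt_smul_rlKernel_add_rlInt (hf : LocInt f) (ha : 0 ≤ a) (hb : 0 < b) (c : ℂ) :
    rlInt a (c • rlKernel b + rlInt b f) =ᵐ[posVol]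
      c • rlKernel (a + b) + rlInt (a + b) f := by
  refine (rlInt_add ((locInt_rlKernel hb).const_smul c) (hf.rlInt hb.le) ha).trans ?_
  rw [rlInt_const_smul]
  exact ((rlInt_rlKernel ha hb).const_smul c).add (rlInt_rlInt hf ha hb.le)

end RLInt

/-! ### Locally absolutely continuous functions -/

section AC

variable {f g g' φ φ' : ℝ → ℂ} {c : ℂ}

theorem IsACRep.congr (h : IsACRep g c φ) (hg : g =ᵐ[posVol] g') (hφ : φ =ᵐ[posVol] φ') :
    IsACRep g' c φ' := by
  refine ⟨h.1.congr hφ, ?_⟩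
  filter_upwards [h.2, hg, ae_restrict_mem measurableSet_Ioi] with x hx hgx hx0
  rw [← hgx, hx, intervalIntegral_congr_ae_Ioi hφ (le_of_lt hx0)]

theorem MemAC.isACRep (h : MemAC g) : IsACRep g (valueAtZero g) (acDeriv g) := by
  obtain ⟨c, φ, hφ⟩ := h
  rw [hφ.valueAtZero_eq]
  exact hφ.congr (ae_eq_refl g) hφ.acDeriv_ae_eq.symm

theorem MemAC.congr (h : MemAC g) (hg : g =ᵐ[posVol] g') : MemAC g' :=
  ⟨_, _, h.isACRep.congr hg (ae_eq_refl _)⟩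

theorem isACRep_iff :
    IsACRep g c φ ↔ LocInt φ ∧ g =ᵐ[posVol] c • rlKernel 1 + rlInt 1 φ := by
  simp only [IsACRep, EventuallyEq, Pi.add_apply, Pi.smul_apply, smul_eq_mul, rlKernel_one,
    mul_one, rlInt_one]

theorem MemAC.locInt (h : MemAC g) : LocInt g :=
  have ⟨hφ, hg⟩ := isACRep_iff.1 h.isACRep
  LocInt.congr (((locInt_rlKernel one_pos).const_smul _).add (hφ.rlInt zero_le_one)) hg.symm

theorem isACRep_rlInt {β : ℝ} (hf : LocInt f) (hβ : 1 ≤ β) :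
    IsACRep (rlInt β f) 0 (rlInt (β - 1) f) := by
  refine isACRep_iff.2 ⟨hf.rlInt (sub_nonneg.2 hβ), ?_⟩
  have h := rlInt_rlInt hf zero_le_one (sub_nonneg.2 hβ)
  rw [add_sub_cancel] at h
  rw [zero_smul, zero_add]
  exact h.symm

theorem IsACRep.rlInt_ae_eq {γ δ : ℝ} (h : IsACRep (rlInt γ f) c φ) (hf : LocInt f)
    (hγ : 0 ≤ γ) (hδ : 0 ≤ δ) (hpos : 0 < δ + 1 - γ) :
    rlInt δ f =ᵐ[posVol] c • rlKernel (δ + 1 - γ) + rlInt (δ + 1 - γ) φ := by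
  obtain ⟨hφ, hrep⟩ := isACRep_iff.1 h
  refine rlInt_injective (hf.rlInt hδ)
    (((locInt_rlKernel hpos).const_smul c).add (hφ.rlInt hpos.le)) hγ ?_
  have hrhs := rlInt_smul_rlKernel_add_rlInt hφ hγ hpos c
  rw [add_sub_cancel] at hrhs
  calc rlInt γ (rlInt δ f)
      =ᵐ[posVol] rlInt (γ + δ) f := rlInt_rlInt hf hγ hδ
    _ =ᵐ[posVol] rlInt δ (rlInt γ f) := add_comm γ δ ▸ (rlInt_rlInt hf hδ hγ).symm
    _ =ᵐ[posVol] rlInt δ (c • rlKernel 1 + rlInt 1 φ) := rlInt_congr hrep δ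
    _ =ᵐ[posVol] c • rlKernel (δ + 1) + rlInt (δ + 1) φ :=
        rlInt_smul_rlKernel_add_rlInt hφ hδ one_pos c
    _ =ᵐ[posVol] rlInt γ (c • rlKernel (δ + 1 - γ) + rlInt (δ + 1 - γ) φ) := hrhs.symm

end AC

/-! ### Inversion of the fractional derivatives -/

section Inversion

variable {α γ₁ γ₂ : ℝ} {f : ℝ → ℂ}

theorem MemDom2L.ae_eq (hf : MemDom2L α γ₁ γ₂ f) (hα : 0 < α) (hγ₁ : 0 ≤ γ₁) (hγ₂ : 0 ≤ γ₂)
    (hle : α + γ₁ + γ₂ ≤ 2) (hlt : 1 < α + γ₁ + γ₂) :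
    f =ᵐ[posVol] rlInt α (deriv2L α γ₁ γ₂ f) +
      (coeffA1 α γ₁ γ₂ f • rlKernel (α + γ₁) +
        coeffA2 α γ₁ γ₂ f • rlKernel (α + γ₁ + γ₂ - 1)) := by
  obtain ⟨hloc, hinner, houter⟩ := hf
  unfold deriv2L coeffA1 coeffA2
  set g := rlInt (2 - α - γ₁ - γ₂) f
  set h := rlInt γ₂ (acDeriv g)
  have hf_eq : f =ᵐ[posVol] valueAtZero g • rlKernel (α + γ₁ + γ₂ - 1) +
      rlInt (α + γ₁ + γ₂ - 1) (acDeriv g) := by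
    have hsub : 0 + 1 - (2 - α - γ₁ - γ₂) = α + γ₁ + γ₂ - 1 := by ring
    have := hinner.isACRep.rlInt_ae_eq hloc (by linarith) le_rfl (by linarith)
    rwa [rlInt_zero, hsub] at this
  have hg_eq : rlInt (α + γ₁ + γ₂ - 1) (acDeriv g) =ᵐ[posVol]
      valueAtZero h • rlKernel (α + γ₁) + rlInt (α + γ₁) (acDeriv h) := by
    have hsub : α + γ₁ + γ₂ - 1 + 1 - γ₂ = α + γ₁ := by ring
    have := houter.isACRep.rlInt_ae_eq (δ := α + γ₁ + γ₂ - 1) hinner.isACRep.1 hγ₂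
      (by linarith) (by linarith)
    rwa [hsub] at this
  filter_upwards [hf_eq, hg_eq, rlInt_rlInt houter.isACRep.1 hα.le hγ₁] with x hfx hgx hx
  rw [hfx, Pi.add_apply, hgx, Pi.add_apply, ← hx, Pi.add_apply, Pi.add_apply]
  ring

end Inversion

/-! ### Types for which the 2nd level derivative is a Hilfer derivative -/

section Degenerate

variable {α γ₁ γ₂ : ℝ} {f : ℝ → ℂ}

theorem one_sub_sub_add_sub_one (α γ₁ γ₂ : ℝ) : 1 - α - (γ₁ + γ₂ - 1) = 2 - α - γ₁ - γ₂ := by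
  ring

theorem MemDomHilfer.isACRep_of_one_le (hf : MemDomHilfer α (γ₁ + γ₂ - 1) f) (h : 1 ≤ γ₂) :
    IsACRep (rlInt γ₂ (acDeriv (rlInt (2 - α - γ₁ - γ₂) f))) 0
      (rlInt (γ₂ - 1) (acDeriv (rlInt (2 - α - γ₁ - γ₂) f))) :=
  isACRep_rlInt (one_sub_sub_add_sub_one α γ₁ γ₂ ▸ hf.2.isACRep.1) h

theorem memDom2L_iff_of_one_le (h : 1 ≤ γ₂) :
    MemDom2L α γ₁ γ₂ f ↔ MemDomHilfer α (γ₁ + γ₂ - 1) f := by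
  rw [MemDom2L, MemDomHilfer, one_sub_sub_add_sub_one]
  exact ⟨fun hf => ⟨hf.1, hf.2.1⟩,
    fun hf => ⟨hf.1, hf.2, _, _, isACRep_rlInt hf.2.isACRep.1 h⟩⟩

theorem MemDomHilfer.deriv2L_ae_eq_of_one_le (hf : MemDomHilfer α (γ₁ + γ₂ - 1) f)
    (hγ₁ : 0 ≤ γ₁) (h : 1 ≤ γ₂) :
    deriv2L α γ₁ γ₂ f =ᵐ[posVol] derivHilfer α (γ₁ + γ₂ - 1) f := by
  rw [deriv2L, derivHilfer, one_sub_sub_add_sub_one, add_sub_assoc]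
  exact (rlInt_congr (hf.isACRep_of_one_le h).acDeriv_ae_eq γ₁).trans
    (rlInt_rlInt (one_sub_sub_add_sub_one α γ₁ γ₂ ▸ hf.2.isACRep.1) hγ₁ (sub_nonneg.2 h))

theorem MemDomHilfer.coeffA1_eq_zero_of_one_le (hf : MemDomHilfer α (γ₁ + γ₂ - 1) f)
    (h : 1 ≤ γ₂) : coeffA1 α γ₁ γ₂ f = 0 :=
  (hf.isACRep_of_one_le h).valueAtZero_eq

theorem coeffA2_eq_valueAtZero (α γ₁ γ₂ : ℝ) (f : ℝ → ℂ) :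
    coeffA2 α γ₁ γ₂ f = valueAtZero (rlInt (1 - α - (γ₁ + γ₂ - 1)) f) := by
  rw [coeffA2, one_sub_sub_add_sub_one]

theorem LocInt.isACRep_of_add_le_one (hf : LocInt f) (h : α + γ₁ + γ₂ ≤ 1) :
    IsACRep (FracCalc.rlInt (2 - α - γ₁ - γ₂) f) 0
      (FracCalc.rlInt (2 - α - γ₁ - γ₂ - 1) f) :=
  isACRep_rlInt hf (by linarith)

theorem LocInt.rlInt_acDeriv_ae_eq_of_add_le_one (hf : LocInt f) (hγ₂ : 0 ≤ γ₂)
    (h : α + γ₁ + γ₂ ≤ 1) :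
    FracCalc.rlInt γ₂ (acDeriv (FracCalc.rlInt (2 - α - γ₁ - γ₂) f)) =ᵐ[posVol]
      FracCalc.rlInt (1 - α - γ₁) f := by
  have horder : γ₂ + (2 - α - γ₁ - γ₂ - 1) = 1 - α - γ₁ := by ring
  rw [← horder]
  exact (rlInt_congr (hf.isACRep_of_add_le_one h).acDeriv_ae_eq γ₂).trans
    (rlInt_rlInt hf hγ₂ (by linarith))

theorem memDom2L_iff_of_add_le_one (hγ₂ : 0 ≤ γ₂) (h : α + γ₁ + γ₂ ≤ 1) :
    MemDom2L α γ₁ γ₂ f ↔ MemDomHilfer α γ₁ f := by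
  refine ⟨fun ⟨hf, _, houter⟩ => ⟨hf, houter.congr ?_⟩, fun ⟨hf, hAC⟩ =>
    ⟨hf, ⟨_, _, hf.isACRep_of_add_le_one h⟩, hAC.congr ?_⟩⟩
  · exact hf.rlInt_acDeriv_ae_eq_of_add_le_one hγ₂ h
  · exact (hf.rlInt_acDeriv_ae_eq_of_add_le_one hγ₂ h).symm

theorem MemDomHilfer.isACRep_of_add_le_one (hf : MemDomHilfer α γ₁ f) (hγ₂ : 0 ≤ γ₂)
    (h : α + γ₁ + γ₂ ≤ 1) :
    IsACRep (rlInt γ₂ (acDeriv (rlInt (2 - α - γ₁ - γ₂) f)))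
      (valueAtZero (rlInt (1 - α - γ₁) f)) (acDeriv (rlInt (1 - α - γ₁) f)) :=
  hf.2.isACRep.congr (hf.1.rlInt_acDeriv_ae_eq_of_add_le_one hγ₂ h).symm (ae_eq_refl _)

theorem MemDomHilfer.deriv2L_ae_eq_of_add_le_one (hf : MemDomHilfer α γ₁ f) (hγ₂ : 0 ≤ γ₂)
    (h : α + γ₁ + γ₂ ≤ 1) : deriv2L α γ₁ γ₂ f =ᵐ[posVol] derivHilfer α γ₁ f :=
  rlInt_congr (hf.isACRep_of_add_le_one hγ₂ h).acDeriv_ae_eq γ₁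

theorem MemDomHilfer.coeffA1_eq_of_add_le_one (hf : MemDomHilfer α γ₁ f) (hγ₂ : 0 ≤ γ₂)
    (h : α + γ₁ + γ₂ ≤ 1) : coeffA1 α γ₁ γ₂ f = valueAtZero (rlInt (1 - α - γ₁) f) :=
  (hf.isACRep_of_add_le_one hγ₂ h).valueAtZero_eq

theorem LocInt.coeffA2_eq_zero_of_add_le_one (hf : LocInt f) (h : α + γ₁ + γ₂ ≤ 1) :
    coeffA2 α γ₁ γ₂ f = 0 :=
  (hf.isACRep_of_add_le_one h).valueAtZero_eq

end Degenerate

/-! ### The Laplace transform -/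

/-- The integrand `f(t) e^{-st}` of the Laplace transform. -/
noncomputable def expWeight (s : ℂ) (f : ℝ → ℂ) (t : ℝ) : ℂ := f t * Complex.exp (-(s * t))

/-- The Laplace integral of `f ∈ L_loc(ℝ₊)` at `s` converges to `F`, possibly conditionally. -/
def HasLaplace (f : ℝ → ℂ) (s F : ℂ) : Prop :=
  LocInt f ∧ Tendsto (fun R : ℝ => ∫ t in (0 : ℝ)..R, expWeight s f t) atTop (𝓝 F)

section Laplace

variable {f g : ℝ → ℂ} {s F G : ℂ} {β : ℝ}

theorem HasLaplace.laplaceExists (h : HasLaplace f s F) : LaplaceExists f s :=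
  ⟨h.1, F, h.2⟩

theorem HasLaplace.laplace_eq (h : HasLaplace f s F) : laplace f s = F :=
  h.2.limUnder_eq

theorem LaplaceExists.hasLaplace (h : LaplaceExists f s) : HasLaplace f s (laplace f s) := by
  obtain ⟨hf, F, hF⟩ := h
  have hFs : HasLaplace f s F := ⟨hf, hF⟩
  rwa [hFs.laplace_eq]

theorem LocInt.expWeight (hf : LocInt f) (s : ℂ) : LocInt (expWeight s f) :=
  hf.mul_continuousOn (by fun_prop) isClosed_Ici.isLocallyClosed

theorem HasLaplace.congr (h : HasLaplace f s F) (hfg : f =ᵐ[posVol] g) : HasLaplace g s F := by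
  refine ⟨h.1.congr hfg, h.2.congr' ?_⟩
  filter_upwards [eventually_ge_atTop 0] with R hR
  exact intervalIntegral_congr_ae_Ioi (hfg.mono fun t ht => congrArg (· * _) ht) hR

theorem LaplaceExists.congr (h : LaplaceExists f s) (hfg : f =ᵐ[posVol] g) : LaplaceExists g s :=
  (h.hasLaplace.congr hfg).laplaceExists

theorem LaplaceExists.laplace_congr (h : LaplaceExists f s) (hfg : f =ᵐ[posVol] g) :
    laplace g s = laplace f s :=
  (h.hasLaplace.congr hfg).laplace_eq

theorem HasLaplace.add (hf : HasLaplace f s F) (hg : HasLaplace g s G) :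
    HasLaplace (f + g) s (F + G) := by
  refine ⟨hf.1.add hg.1, (hf.2.add hg.2).congr' ?_⟩
  filter_upwards [eventually_ge_atTop 0] with R hR
  rw [← intervalIntegral.integral_add
    (intervalIntegrable_of_locallyIntegrableOn_Ici (hf.1.expWeight s) hR)
    (intervalIntegrable_of_locallyIntegrableOn_Ici (hg.1.expWeight s) hR)]
  simp only [expWeight, Pi.add_apply, add_mul]

theorem HasLaplace.const_smul (hf : HasLaplace f s F) (c : ℂ) :
    HasLaplace (c • f) s (c * F) := by
  refine ⟨hf.1.const_smul c, (hf.2.const_mul c).congr fun R => ?_⟩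
  rw [← intervalIntegral.integral_const_mul]
  simp only [expWeight, Pi.smul_apply, smul_eq_mul, mul_assoc]

theorem hasLaplace_of_tendsto_setIntegral (hf : LocInt f)
    (h : Tendsto (fun R => ∫ t in Ioc 0 R, expWeight s f t) atTop (𝓝 F)) :
    HasLaplace f s F := by
  refine ⟨hf, h.congr' ?_⟩
  filter_upwards [eventually_ge_atTop 0] with R hR
  rw [intervalIntegral.integral_of_le hR]

theorem HasLaplace.tendsto_setIntegral (h : HasLaplace f s F) :
    Tendsto (fun R => ∫ t in Ioc 0 R, expWeight s f t) atTop (𝓝 F) := by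
  refine h.2.congr' ?_
  filter_upwards [eventually_ge_atTop 0] with R hR
  rw [intervalIntegral.integral_of_le hR]

theorem expWeight_posConvolution (s : ℂ) (f g : ℝ → ℂ) :
    expWeight s (f ⋆₊ g) = expWeight s f ⋆₊ expWeight s g := by
  funext x
  rcases le_or_gt x 0 with hx | hx
  · simp only [expWeight, posConvolution, indicator_of_notMem (notMem_Ioi.2 hx), zero_mul]
  rw [expWeight, posConvolution_of_pos _ _ _ hx, posConvolution_of_pos _ _ _ hx,
    ← intervalIntegral.integral_mul_const]
  refine intervalIntegral.integral_congr fun t _ => ?_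
  have hexp : Complex.exp (-(s * x)) =
      Complex.exp (-(s * t)) * Complex.exp (-(s * ((x - t : ℝ) : ℂ))) := by
    rw [← Complex.exp_add]; push_cast; ring_nf
  simp only [ContinuousLinearMap.mul_apply', expWeight, hexp]
  ring

theorem norm_expWeight (s : ℂ) (f : ℝ → ℂ) (t : ℝ) :
    ‖expWeight s f t‖ = ‖f t‖ * Real.exp (-s.re * t) := by
  rw [expWeight, norm_mul, Complex.norm_exp, Complex.neg_re, Complex.re_mul_ofReal, neg_mul]

theorem integrableOn_rpow_div_Gamma_mul_exp (hβ : 0 < β) {r : ℝ} (hr : 0 < r) :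
    IntegrableOn (fun t => t ^ (β - 1) / Real.Gamma β * Real.exp (-r * t)) (Ioi 0) := by
  have h := (integrableOn_rpow_mul_exp_neg_mul_rpow (p := 1) (s := β - 1) (b := r)
    (by linarith) one_pos hr).div_const (Real.Gamma β)
  refine h.congr (Eventually.of_forall fun t => ?_)
  simp only [Real.rpow_one, div_mul_eq_mul_div]

theorem integrableOn_expWeight_rlKernel (hβ : 0 < β) (hs : 0 < s.re) :
    IntegrableOn (expWeight s (rlKernel β)) (Ioi 0) := by
  refine (integrableOn_rpow_div_Gamma_mul_exp hβ hs).mono'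
    ((((locInt_rlKernel hβ).expWeight s).aestronglyMeasurable).mono_set Ioi_subset_Ici_self) ?_
  filter_upwards [ae_restrict_mem measurableSet_Ioi] with t ht
  have hk : 0 ≤ t ^ (β - 1) / Real.Gamma β :=
    div_nonneg (Real.rpow_nonneg (le_of_lt ht) _) (Real.Gamma_pos_of_pos hβ).le
  rw [norm_expWeight, rlKernel, Complex.norm_real, Real.norm_of_nonneg hk]

theorem analyticOnNhd_integral_expWeight_rlKernel (hβ : 0 < β) :
    AnalyticOnNhd ℂ (fun z => ∫ t in Ioi (0 : ℝ), expWeight z (rlKernel β) t)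
      {z | 0 < z.re} := by
  set w : ℝ → ENNReal := fun t => ENNReal.ofReal (t ^ (β - 1) / Real.Gamma β)
  have hw : Measurable w := by fun_prop
  have hw_top : ∀ᵐ t ∂posVol, w t < ⊤ := Eventually.of_forall fun t => ENNReal.ofReal_lt_top
  have hw_toReal {t : ℝ} (ht : 0 < t) : (w t).toReal = t ^ (β - 1) / Real.Gamma β :=
    ENNReal.toReal_ofReal
      (div_nonneg (Real.rpow_nonneg ht.le _) (Real.Gamma_pos_of_pos hβ).le)
  set μ := posVol.withDensity w
  have hexp : Ioi 0 ⊆ interior (ProbabilityTheory.integrableExpSet (fun t : ℝ => -t) μ) := by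
    refine interior_maximal (fun r hr => ?_) isOpen_Ioi
    refine (integrable_withDensity_iff_integrable_smul' hw hw_top).2
      ((integrableOn_rpow_div_Gamma_mul_exp hβ hr).congr ?_)
    filter_upwards [ae_restrict_mem measurableSet_Ioi] with t ht
    rw [hw_toReal ht, smul_eq_mul, neg_mul_comm]
  refine (ProbabilityTheory.analyticOnNhd_complexMGF.mono fun z hz => hexp hz).congr
    (isOpen_lt continuous_const Complex.continuous_re) fun z _ => ?_
  rw [ProbabilityTheory.complexMGF, integral_withDensity_eq_integral_toReal_smul hw hw_top]
  refine setIntegral_congr_fun measurableSet_Ioi fun t ht => ?_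
  simp only [hw_toReal ht, Complex.real_smul, expWeight, rlKernel, Complex.ofReal_neg, mul_neg]

theorem integral_expWeight_rlKernel_ofReal (hβ : 0 < β) {r : ℝ} (hr : 0 < r) :
    ∫ t in Ioi (0 : ℝ), expWeight r (rlKernel β) t = (r : ℂ) ^ (-β : ℂ) := by
  have hΓ : Complex.Gamma β ≠ 0 := Complex.Gamma_ne_zero_of_re_pos (by simpa using hβ)
  have harg : Complex.arg r ≠ Real.pi := by
    rw [Complex.arg_ofReal_of_nonneg hr.le]; exact Real.pi_ne_zero.symm
  calc ∫ t in Ioi (0 : ℝ), expWeight r (rlKernel β) t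
      = (Complex.Gamma β)⁻¹ *
          ∫ t in Ioi (0 : ℝ), (t : ℂ) ^ ((β : ℂ) - 1) * Complex.exp (-(r * t)) := by
        rw [← integral_const_mul]
        refine setIntegral_congr_fun measurableSet_Ioi fun t ht => ?_
        simp only [expWeight, rlKernel_eq_cpow β (le_of_lt ht), mul_assoc]
    _ = (Complex.Gamma β)⁻¹ * ((1 / r) ^ (β : ℂ) * Complex.Gamma β) := by
        rw [Complex.integral_cpow_mul_exp_neg_mul_Ioi (by simpa using hβ) hr]
    _ = (r : ℂ) ^ (-β : ℂ) := by
        rw [Complex.cpow_neg, one_div, Complex.inv_cpow _ _ harg]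
        field_simp

theorem integral_expWeight_rlKernel (hβ : 0 < β) (hs : 0 < s.re) :
    ∫ t in Ioi (0 : ℝ), expWeight s (rlKernel β) t = s ^ (-β : ℂ) := by
  have hcpow : AnalyticOnNhd ℂ (fun z : ℂ => z ^ (-β : ℂ)) {z | 0 < z.re} :=
    fun z hz => analyticAt_id.cpow analyticAt_const (Or.inl hz)
  refine (analyticOnNhd_integral_expWeight_rlKernel hβ).eqOn_of_preconnected_of_frequently_eq
    hcpow (convex_halfSpace_re_gt 0).isPreconnected (z₀ := ((1 : ℝ) : ℂ)) (by simp) ?_ hs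
  have hreal : Tendsto (fun r : ℝ => (r : ℂ)) (𝓝[>] 1) (𝓝[≠] ((1 : ℝ) : ℂ)) :=
    Complex.continuous_ofReal.continuousWithinAt.tendsto_nhdsWithin
      fun r hr => Complex.ofReal_injective.ne (ne_of_gt hr)
  refine hreal.frequently (Eventually.frequently ?_)
  filter_upwards [self_mem_nhdsWithin] with r hr
  exact integral_expWeight_rlKernel_ofReal hβ (one_pos.trans hr)

theorem hasLaplace_rlKernel (hβ : 0 < β) (hs : 0 < s.re) :
    HasLaplace (rlKernel β) s (s ^ (-β : ℂ)) := by
  rw [← integral_expWeight_rlKernel hβ hs]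
  exact ⟨locInt_rlKernel hβ, intervalIntegral_tendsto_integral_Ioi 0
    (integrableOn_expWeight_rlKernel hβ hs) tendsto_id⟩

theorem HasLaplace.rlInt (hf : HasLaplace f s F) (hβ : 0 < β) (hs : 0 < s.re) :
    HasLaplace (rlInt β f) s (s ^ (-β : ℂ) * F) := by
  have h := tendsto_setIntegral_Ioc_posConvolution (ContinuousLinearMap.mul ℝ ℂ)
    (integrableOn_expWeight_rlKernel hβ hs) (hf.1.expWeight s) hf.tendsto_setIntegral
  rw [integral_expWeight_rlKernel hβ hs, ← expWeight_posConvolution] at h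
  have hcomm : f ⋆₊ rlKernel β = rlKernel β ⋆₊ f := by
    rw [← posConvolution_flip, ContinuousLinearMap.flip_mul]
  refine (hasLaplace_of_tendsto_setIntegral ?_ h).congr
    (hcomm ▸ rlInt_ae_eq_posConvolution hβ.ne' f).symm
  exact locallyIntegrableOn_posConvolution _ (locInt_rlKernel hβ) hf.1

end Laplace

/-! ### Laplace transforms of the fractional derivatives -/

section LaplaceDeriv

variable {α γ γ₁ γ₂ : ℝ} {f : ℝ → ℂ} {s F : ℂ}

theorem MemDom2L.hasLaplace (hf : MemDom2L α γ₁ γ₂ f) (hα : 0 < α) (hγ₁ : 0 ≤ γ₁)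
    (hγ₂ : 0 ≤ γ₂) (hle : α + γ₁ + γ₂ ≤ 2) (hlt : 1 < α + γ₁ + γ₂) (hs : 0 < s.re)
    (hD : HasLaplace (deriv2L α γ₁ γ₂ f) s F) :
    HasLaplace f s (s ^ (-α : ℂ) *
      (F + coeffA1 α γ₁ γ₂ f * s ^ (-γ₁ : ℂ) + coeffA2 α γ₁ γ₂ f * s ^ (1 - γ₁ - γ₂ : ℂ))) := by
  have hs0 : s ≠ 0 := fun h => by simp [h] at hs
  have hcpow₁ : s ^ (-((α + γ₁ : ℝ) : ℂ)) = s ^ (-α : ℂ) * s ^ (-γ₁ : ℂ) := by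
    rw [← Complex.cpow_add _ _ hs0]; push_cast; ring_nf
  have hcpow₂ : s ^ (-((α + γ₁ + γ₂ - 1 : ℝ) : ℂ)) =
      s ^ (-α : ℂ) * s ^ (1 - γ₁ - γ₂ : ℂ) := by
    rw [← Complex.cpow_add _ _ hs0]; push_cast; ring_nf
  have hk₁ := hasLaplace_rlKernel (add_pos_of_pos_of_nonneg hα hγ₁) hs
  have hk₂ := hasLaplace_rlKernel (sub_pos.2 hlt) hs
  rw [hcpow₁] at hk₁
  rw [hcpow₂] at hk₂
  convert ((hD.rlInt hα hs).add ((hk₁.const_smul _).add (hk₂.const_smul _))).congr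
    (hf.ae_eq hα hγ₁ hγ₂ hle hlt).symm using 1
  ring

theorem MemDom2L.laplace_deriv2L (hf : MemDom2L α γ₁ γ₂ f) (hα : 0 < α) (hγ₁ : 0 ≤ γ₁)
    (hγ₂ : 0 ≤ γ₂) (hle : α + γ₁ + γ₂ ≤ 2) (hlt : 1 < α + γ₁ + γ₂) (hs : 0 < s.re)
    (hD : LaplaceExists (deriv2L α γ₁ γ₂ f) s) :
    LaplaceExists f s ∧ laplace (deriv2L α γ₁ γ₂ f) s =
      s ^ (α : ℂ) * laplace f s - coeffA1 α γ₁ γ₂ f * s ^ (-γ₁ : ℂ)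
        - coeffA2 α γ₁ γ₂ f * s ^ (1 - γ₁ - γ₂ : ℂ) := by
  have hL := hf.hasLaplace hα hγ₁ hγ₂ hle hlt hs hD.hasLaplace
  have hs0 : s ≠ 0 := fun h => by simp [h] at hs
  have hcancel : s ^ (α : ℂ) * s ^ (-α : ℂ) = 1 := by
    rw [← Complex.cpow_add _ _ hs0, add_neg_cancel, Complex.cpow_zero]
  refine ⟨hL.laplaceExists, ?_⟩
  rw [hL.laplace_eq, ← mul_assoc, hcancel]
  ring

theorem MemDomHilfer.laplace_derivHilfer (hf : MemDomHilfer α γ f) (hα : 0 < α) (hγ : 0 ≤ γ)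
    (hle : α + γ ≤ 1) (hs : 0 < s.re) (hD : LaplaceExists (derivHilfer α γ f) s) :
    LaplaceExists f s ∧ laplace (derivHilfer α γ f) s =
      s ^ (α : ℂ) * laplace f s - valueAtZero (rlInt (1 - α - γ) f) * s ^ (-γ : ℂ) := by
  have htype : γ + 1 - 1 = γ := add_sub_cancel_right γ 1
  have hf' : MemDomHilfer α (γ + 1 - 1) f := by rwa [htype]
  have hDeq : derivHilfer α γ f =ᵐ[posVol] deriv2L α γ 1 f := by
    simpa only [htype] using (hf'.deriv2L_ae_eq_of_one_le hγ le_rfl).symm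
  have h := ((memDom2L_iff_of_one_le le_rfl).2 hf').laplace_deriv2L hα hγ zero_le_one
    (by linarith) (by linarith) hs (hD.congr hDeq)
  have hexp : (1 - γ - (1 : ℝ) : ℂ) = -γ := by push_cast; ring
  rwa [hD.laplace_congr hDeq, hf'.coeffA1_eq_zero_of_one_le le_rfl, coeffA2_eq_valueAtZero,
    htype, hexp, zero_mul, sub_zero] at h

theorem memDomHilfer_zero_iff : MemDomHilfer α 0 f ↔ MemDomRL α f := by
  rw [MemDomHilfer, MemDomRL, sub_zero]

theorem derivHilfer_zero (α : ℝ) (f : ℝ → ℂ) : derivHilfer α 0 f = derivRL α f := by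
  rw [derivHilfer, derivRL, rlInt_zero, sub_zero]

theorem MemDomRL.laplace_derivRL (hf : MemDomRL α f) (hα : 0 < α) (hα1 : α ≤ 1) (hs : 0 < s.re)
    (hD : LaplaceExists (derivRL α f) s) :
    LaplaceExists f s ∧ laplace (derivRL α f) s =
      s ^ (α : ℂ) * laplace f s - valueAtZero (rlInt (1 - α) f) := by
  rw [← derivHilfer_zero] at hD ⊢
  have h := (memDomHilfer_zero_iff.2 hf).laplace_derivHilfer hα le_rfl (by rwa [add_zero]) hs hD
  rwa [sub_zero, Complex.ofReal_zero, neg_zero, Complex.cpow_zero, mul_one] at h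

theorem MemAC.memDomHilfer_one_sub (hf : MemAC f) (α : ℝ) : MemDomHilfer α (1 - α) f :=
  ⟨hf.locInt, by rwa [sub_self, rlInt_zero]⟩

theorem derivHilfer_one_sub (α : ℝ) (f : ℝ → ℂ) :
    derivHilfer α (1 - α) f = derivCaputo α f := by
  rw [derivHilfer, derivCaputo, sub_self, rlInt_zero]

theorem MemAC.laplace_derivCaputo (hf : MemAC f) (hα : 0 < α) (hα1 : α ≤ 1) (hs : 0 < s.re)
    (hD : LaplaceExists (derivCaputo α f) s) :
    LaplaceExists f s ∧ laplace (derivCaputo α f) s =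
      s ^ (α : ℂ) * laplace f s - valueAtZero f * s ^ (α - 1 : ℂ) := by
  rw [← derivHilfer_one_sub] at hD ⊢
  have h := (hf.memDomHilfer_one_sub α).laplace_derivHilfer hα (sub_nonneg.2 hα1)
    (add_sub_cancel α 1).le hs hD
  rwa [sub_self, rlInt_zero, Complex.ofReal_sub, Complex.ofReal_one, neg_sub] at h

end LaplaceDeriv

end FracCalc

open FracCalc in
theorem mainTheorem4_general (α : ℝ) (hα : 0 < α) :
    (∀ γ₁ γ₂ : ℝ, 0 ≤ γ₁ → 0 ≤ γ₂ → α + γ₁ + γ₂ ≤ 2 → 1 < α + γ₁ + γ₂ →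
      ∀ f : ℝ → ℂ, MemDom2L α γ₁ γ₂ f →
      ∀ s : ℂ, 0 < s.re → LaplaceExists (deriv2L α γ₁ γ₂ f) s →
        LaplaceExists f s ∧
        laplace (deriv2L α γ₁ γ₂ f) s =
          s ^ (α : ℂ) * laplace f s - coeffA1 α γ₁ γ₂ f * s ^ (-γ₁ : ℂ)
            - coeffA2 α γ₁ γ₂ f * s ^ (1 - γ₁ - γ₂ : ℂ)) ∧
    (∀ γ₁ γ₂ : ℝ, 0 ≤ γ₁ → α + γ₁ + γ₂ ≤ 2 → 1 ≤ γ₂ →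
      ∀ f : ℝ → ℂ, (MemDom2L α γ₁ γ₂ f ↔ MemDomHilfer α (γ₁ + γ₂ - 1) f) ∧
        (MemDom2L α γ₁ γ₂ f →
          deriv2L α γ₁ γ₂ f =ᵐ[posVol] derivHilfer α (γ₁ + γ₂ - 1) f ∧
          coeffA1 α γ₁ γ₂ f = 0 ∧
          coeffA2 α γ₁ γ₂ f = valueAtZero (rlInt (1 - α - (γ₁ + γ₂ - 1)) f))) ∧
    (∀ γ₁ γ₂ : ℝ, 0 ≤ γ₁ → 0 ≤ γ₂ → α + γ₁ + γ₂ ≤ 1 →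
      ∀ f : ℝ → ℂ, (MemDom2L α γ₁ γ₂ f ↔ MemDomHilfer α γ₁ f) ∧
        (MemDom2L α γ₁ γ₂ f →
          deriv2L α γ₁ γ₂ f =ᵐ[posVol] derivHilfer α γ₁ f ∧
          coeffA1 α γ₁ γ₂ f = valueAtZero (rlInt (1 - α - γ₁) f) ∧
          coeffA2 α γ₁ γ₂ f = 0)) ∧
    (∀ γ₁ : ℝ, 0 ≤ γ₁ → α + γ₁ ≤ 1 →
      ∀ f : ℝ → ℂ, MemDomHilfer α γ₁ f →
      ∀ s : ℂ, 0 < s.re → LaplaceExists (derivHilfer α γ₁ f) s →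
        LaplaceExists f s ∧
        laplace (derivHilfer α γ₁ f) s =
          s ^ (α : ℂ) * laplace f s - valueAtZero (rlInt (1 - α - γ₁) f) * s ^ (-γ₁ : ℂ)) ∧
    (α ≤ 1 → ∀ f : ℝ → ℂ, MemDomRL α f →
      (MemDomHilfer α 0 f ∧ derivHilfer α 0 f = derivRL α f) ∧
      ∀ s : ℂ, 0 < s.re → LaplaceExists (derivRL α f) s →
        LaplaceExists f s ∧
        laplace (derivRL α f) s =
          s ^ (α : ℂ) * laplace f s - valueAtZero (rlInt (1 - α) f)) ∧
    (α ≤ 1 → ∀ f : ℝ → ℂ, MemAC f →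
      (MemDomHilfer α (1 - α) f ∧ derivHilfer α (1 - α) f = derivCaputo α f) ∧
      ∀ s : ℂ, 0 < s.re → LaplaceExists (derivCaputo α f) s →
        LaplaceExists f s ∧
        laplace (derivCaputo α f) s =
          s ^ (α : ℂ) * laplace f s - valueAtZero f * s ^ (α - 1 : ℂ)) := by
  refine ⟨fun γ₁ γ₂ hγ₁ hγ₂ hle hlt f hf s => hf.laplace_deriv2L hα hγ₁ hγ₂ hle hlt,
    fun γ₁ γ₂ hγ₁ _ h f => ⟨memDom2L_iff_of_one_le h, fun hf => ?_⟩,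
    fun γ₁ γ₂ _ hγ₂ h f => ⟨memDom2L_iff_of_add_le_one hγ₂ h, fun hf => ?_⟩,
    fun γ₁ hγ₁ hle f hf s => hf.laplace_derivHilfer hα hγ₁ hle,
    fun hα1 f hf => ⟨⟨memDomHilfer_zero_iff.2 hf, derivHilfer_zero α f⟩,
      fun s => hf.laplace_derivRL hα hα1⟩,
    fun hα1 f hf => ⟨⟨hf.memDomHilfer_one_sub α, derivHilfer_one_sub α f⟩,
      fun s => hf.laplace_derivCaputo hα hα1⟩⟩
  · have hH := (memDom2L_iff_of_one_le h).1 hf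
    exact ⟨hH.deriv2L_ae_eq_of_one_le hγ₁ h, hH.coeffA1_eq_zero_of_one_le h,
      coeffA2_eq_valueAtZero α γ₁ γ₂ f⟩
  · have hH := (memDom2L_iff_of_add_le_one hγ₂ h).1 hf
    exact ⟨hH.deriv2L_ae_eq_of_add_le_one hγ₂ h, hH.coeffA1_eq_of_add_le_one hγ₂ h,
      hH.1.coeffA2_eq_zero_of_add_le_one h⟩

open FracCalc in
theorem mainTheorem4 (α : ℝ) (hα : 0 < α) (hα1 : α ≤ 1) :
    -- the truly 2nd level derivative
    (∀ γ₁ γ₂ : ℝ, 0 ≤ γ₁ → 0 ≤ γ₂ → α + γ₁ ≤ 1 → α + γ₁ + γ₂ ≤ 2 →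
      γ₂ < 1 → 1 < α + γ₁ + γ₂ →
      ∀ f : ℝ → ℂ, MemDom2L α γ₁ γ₂ f →
      ∀ s : ℂ, 0 < s.re → LaplaceExists (deriv2L α γ₁ γ₂ f) s →
        LaplaceExists f s ∧
        laplace (deriv2L α γ₁ γ₂ f) s =
          s ^ (α : ℂ) * laplace f s - coeffA1 α γ₁ γ₂ f * s ^ (-γ₁ : ℂ)
            - coeffA2 α γ₁ γ₂ f * s ^ (1 - γ₁ - γ₂ : ℂ)) ∧
    -- degenerate types: the Hilfer derivative of type `γ₁ + γ₂ - 1` if `1 ≤ γ₂`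
    (∀ γ₁ γ₂ : ℝ, 0 ≤ γ₁ → 0 ≤ γ₂ → α + γ₁ ≤ 1 → α + γ₁ + γ₂ ≤ 2 → 1 ≤ γ₂ →
      ∀ f : ℝ → ℂ, (MemDom2L α γ₁ γ₂ f ↔ MemDomHilfer α (γ₁ + γ₂ - 1) f) ∧
        (MemDom2L α γ₁ γ₂ f →
          deriv2L α γ₁ γ₂ f =ᵐ[volume.restrict (Ioi (0 : ℝ))]
            derivHilfer α (γ₁ + γ₂ - 1) f ∧
          coeffA1 α γ₁ γ₂ f = 0 ∧
          coeffA2 α γ₁ γ₂ f = valueAtZero (rlInt (1 - α - (γ₁ + γ₂ - 1)) f))) ∧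
    -- degenerate types: the Hilfer derivative of type `γ₁` if `α + γ₁ + γ₂ ≤ 1`
    (∀ γ₁ γ₂ : ℝ, 0 ≤ γ₁ → 0 ≤ γ₂ → α + γ₁ ≤ 1 → α + γ₁ + γ₂ ≤ 2 → α + γ₁ + γ₂ ≤ 1 →
      ∀ f : ℝ → ℂ, (MemDom2L α γ₁ γ₂ f ↔ MemDomHilfer α γ₁ f) ∧
        (MemDom2L α γ₁ γ₂ f →
          deriv2L α γ₁ γ₂ f =ᵐ[volume.restrict (Ioi (0 : ℝ))] derivHilfer α γ₁ f ∧
          coeffA1 α γ₁ γ₂ f = valueAtZero (rlInt (1 - α - γ₁) f) ∧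
          coeffA2 α γ₁ γ₂ f = 0)) ∧
    -- Hilfer
    (∀ γ₁ : ℝ, 0 ≤ γ₁ → α + γ₁ ≤ 1 →
      ∀ f : ℝ → ℂ, MemDomHilfer α γ₁ f →
      ∀ s : ℂ, 0 < s.re → LaplaceExists (derivHilfer α γ₁ f) s →
        LaplaceExists f s ∧
        laplace (derivHilfer α γ₁ f) s =
          s ^ (α : ℂ) * laplace f s - valueAtZero (rlInt (1 - α - γ₁) f) * s ^ (-γ₁ : ℂ)) ∧
    -- Riemann-Liouville: `γ₁ = 0`
    (∀ f : ℝ → ℂ, MemDomRL α f →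
      (MemDomHilfer α 0 f ∧ derivHilfer α 0 f = derivRL α f) ∧
      ∀ s : ℂ, 0 < s.re → LaplaceExists (derivRL α f) s →
        LaplaceExists f s ∧
        laplace (derivRL α f) s =
          s ^ (α : ℂ) * laplace f s - valueAtZero (rlInt (1 - α) f)) ∧
    -- Caputo: `γ₁ = 1 - α`
    (∀ f : ℝ → ℂ, MemAC f →
      (MemDomHilfer α (1 - α) f ∧ derivHilfer α (1 - α) f = derivCaputo α f) ∧
      ∀ s : ℂ, 0 < s.re → LaplaceExists (derivCaputo α f) s →
        LaplaceExists f s ∧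
        laplace (derivCaputo α f) s =
          s ^ (α : ℂ) * laplace f s - valueAtZero f * s ^ (α - 1 : ℂ)) := by
  obtain ⟨hTwo, hOneLe, hAddLe, hHilfer, hRL, hCaputo⟩ := mainTheorem4_general α hα
  exact ⟨fun γ₁ γ₂ hγ₁ hγ₂ _ hle _ hlt => hTwo γ₁ γ₂ hγ₁ hγ₂ hle hlt,
    fun γ₁ γ₂ hγ₁ _ _ hle h => hOneLe γ₁ γ₂ hγ₁ hle h,
    fun γ₁ γ₂ hγ₁ hγ₂ _ _ h => hAddLe γ₁ γ₂ hγ₁ hγ₂ h, hHilfer, hRL hα1, hCaputo hα1⟩
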